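/- Let $R$ be a reflexive binary relation on a set $U$. For $x\in U$ put $R(x)=\{y\in U\mid (x,y)\in R\}$, and for $X\subseteq U$ let $X^\blacktriangledown=\{x\in U\mid R(x)\subseteq X\}$ and $X^\blacktriangle=\{x\in U\mid R(x)\cap X\neq\emptyset\}$ be the lower and upper approximations of $X$. Let $\mathrm{RS}=\{(X^\blacktriangledown,X^\blacktriangle)\mid X\subseteq U\}$, ordered by coordinatewise inclusion, and let $\mathrm{DM(RS)}$ be its Dedekind--MacNeille completion. A double Stone algebra is a bounded distributive lattice in which every element $x$ has a pseudocomplement $x^*$ and a dual pseudocomplement $x^+$ (so that $z\le x^*\iff x\wedge z=0$ and $x^+\le z\iff x\vee z=1$), and in which $x^*\vee x^{**}=1$ and $x^+\wedge x^{++}=0$ for all $x$. It is regular if $x^*=y^*$ and $x^+=y^+$ imply $x=y$. A complete lattice $L$ is completely distributive if $\bigwedge_{i\in I}\bigvee_{j\in J}a_{i,j}=\bigvee_{f\colon I\to J}\bigwedge_{i\in I}a_{i,f(i)}$ for all families $(a_{i,j})_{i\in I,\,j\in J}$ in $L$. It is spatial if each of its elements is the join of the completely join-irreducible elements below it, where $j\neq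 0$ is completely join-irreducible if $j=\bigvee S$ implies $j\in S$ for every $S\subseteq L$. A family $\mathcal H$ of nonempty subsets of $U$ is a covering of $U$ if $\bigcup\mathcal H=U$; a covering $\mathcal H$ is irredundant if $\mathcal H\setminus\{X\}$ is not a covering of $U$ for any $X\in\mathcal H$. The reflexive relation $R$ is called a clinker equivalence if $\{\{x\}^\blacktriangle\mid x\in U\}$ is an irredundant covering of $U$. **Proposition.** Let $R$ be a reflexive relation on $U$. Then $\mathrm{DM(RS)}$ forms a regular double Stone algebra defined on a completely distributive spatial lattice if and only if $R$ is a clinker equivalence. -/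

import Mathlib

universe u

namespace RoughSet

section Lattices

/-- Complete distributivity of a complete lattice: every meet of joins of a doubly indexed
family is the join, over all choice functions, of the corresponding meets. -/
def IsCompletelyDistributive (L : Type u) [CompleteLattice L] : Prop :=
  ∀ (I J : Type u) (a : I → J → L),
    (⨅ i, ⨆ j, a i j) = ⨆ f : I → J, ⨅ i, a i (f i)

/-- Completely join-irreducible elements of a complete lattice. -/
def IsCompletelyJoinIrreducible {L : Type u} [CompleteLattice L] (j : L) : Prop :=
  j ≠ ⊥ ∧ ∀ S : Set L, j = sSup S → j ∈ S

/-- A complete lattice is spatial if every element is the join of the completely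
join-irreducible elements below it. -/
def IsSpatial (L : Type u) [CompleteLattice L] : Prop :=
  ∀ a : L, a = sSup {j : L | IsCompletelyJoinIrreducible j ∧ j ≤ a}

/-- `(L, ∨, ∧, star, plus, 0, 1)` is a double Stone algebra: a bounded distributive lattice with
pseudocomplement `star` and dual pseudocomplement `plus` satisfying the Stone identity and its
dual. -/
structure IsDoubleStoneAlgebra {L : Type u} [Lattice L] [BoundedOrder L]
    (star plus : L → L) : Prop where
  distrib : ∀ x y z : L, x ⊓ (y ⊔ z) = (x ⊓ y) ⊔ (x ⊓ z)
  star_spec : ∀ x z : L, z ≤ star x ↔ x ⊓ z = ⊥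
  plus_spec : ∀ x z : L, plus x ≤ z ↔ x ⊔ z = ⊤
  stone : ∀ x : L, star x ⊔ star (star x) = ⊤
  dual_stone : ∀ x : L, plus x ⊓ plus (plus x) = ⊥

/-- A double Stone algebra is regular if every element is determined by its pseudocomplement
together with its dual pseudocomplement. -/
structure IsRegularDoubleStoneAlgebra {L : Type u} [Lattice L] [BoundedOrder L]
    (star plus : L → L) : Prop extends IsDoubleStoneAlgebra star plus where
  regular : ∀ x y : L, star x = star y → plus x = plus y → x = y

/-- The bounded lattice `L` forms a regular double Stone algebra, with respect to its (necessarily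
unique) operations of pseudocomplementation and dual pseudocomplementation. -/
def FormsRegularDoubleStoneAlgebra (L : Type u) [Lattice L] [BoundedOrder L] : Prop :=
  ∃ star plus : L → L, IsRegularDoubleStoneAlgebra star plus

end Lattices

section Approximations

variable {U : Type u}

/-- The neighbourhood `R(x)`. -/
def neighbourhood (R : U → U → Prop) (x : U) : Set U := {y | R x y}

/-- The lower approximation of `X`. -/
def lower (R : U → U → Prop) (X : Set U) : Set U := {x | neighbourhood R x ⊆ X}

/-- The upper approximation of `X`. -/
def upper (R : U → U → Prop) (X : Set U) : Set U := {x | (neighbourhood R x ∩ X).Nonempty}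

/-- The set of all rough sets; as a type it carries the coordinatewise inclusion order. -/
def RS (R : U → U → Prop) : Set (Set U × Set U) := {p | ∃ X : Set U, p = (lower R X, upper R X)}

/-- The Dedekind–MacNeille completion of the ordered set of rough sets. -/
abbrev DMRS (R : U → U → Prop) : Type u := DedekindCut (RS R)

/-- A covering of `U`: a family of nonempty subsets whose union is `U`. -/
def IsCovering (H : Set (Set U)) : Prop := (∀ X ∈ H, X.Nonempty) ∧ ⋃₀ H = Set.univ

/-- A covering is irredundant if removing any of its members destroys the covering property. -/
def IsIrredundantCovering (H : Set (Set U)) : Prop :=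
  IsCovering H ∧ ∀ X ∈ H, ¬ IsCovering (H \ {X})

/-- Clinker equivalences: reflexive relations such that the upper approximations of the singletons
form an irredundant covering. -/
structure IsClinkerEquivalence (R : U → U → Prop) : Prop where
  refl : ∀ x, R x x
  irredundant : IsIrredundantCovering {Y : Set U | ∃ x : U, Y = upper R {x}}

end Approximations

end RoughSet

/-! Both directions pass through cores: by `isClinkerEquivalence_iff`, clinker means that each `x`
has some `w` with `R w x` such that all points of `R(w)` have the same upper approximation as `x`.
From algebra to cores: call `x` thick if `R(x)` is not contained in `{x}`. A thick singleton has
empty lower part, so its dual pseudocomplement is `⊤` and regularity makes it determined by its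
`star`. Spatiality then yields an atom `{z}` below it. As `{z}* ≤ {z}ᶜ < ⊤`, the Stone identity
forces `{z}**` out of `{z}ᶜ`; only some `R(w)` containing `z` can witness this, and regularity
identifies its points with the atom (`exists_core_of_isAtom`). From cores to algebra: evaluating
approximations at the cores identifies rough sets with nested pairs over the quotient
(`nonempty_orderIso_nestedPairs`). These are already a complete lattice, so completion adds nothing,
and all three properties can be read off the pairs. -/

namespace RoughSet

/-! ### Regular double Stone algebras -/

section Algebra

variable {L : Type u}

namespace IsDoubleStoneAlgebra

variable [Lattice L] [BoundedOrder L] {star plus : L → L}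

theorem inf_star (h : IsDoubleStoneAlgebra star plus) (x : L) : x ⊓ star x = ⊥ :=
  (h.star_spec x _).1 le_rfl

theorem sup_plus (h : IsDoubleStoneAlgebra star plus) (x : L) : x ⊔ plus x = ⊤ :=
  (h.plus_spec x _).1 le_rfl

theorem star_anti (h : IsDoubleStoneAlgebra star plus) {x y : L} (hxy : x ≤ y) :
    star y ≤ star x :=
  (h.star_spec x _).2 <| le_bot_iff.1 <| (inf_le_inf_right _ hxy).trans (h.inf_star y).le

theorem le_star_star (h : IsDoubleStoneAlgebra star plus) (x : L) : x ≤ star (star x) :=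
  (h.star_spec _ _).2 <| by rw [inf_comm, h.inf_star]

theorem eq_bot_of_le_star (h : IsDoubleStoneAlgebra star plus) {x y : L}
    (h₁ : y ≤ star x) (h₂ : y ≤ star (star x)) : y = ⊥ :=
  le_bot_iff.1 <| (le_inf h₁ h₂).trans (h.inf_star (star x)).le

end IsDoubleStoneAlgebra

namespace IsRegularDoubleStoneAlgebra

/-- A completely join-irreducible element dominates no other nonzero element with the same dual
pseudocomplement. -/
theorem eq_of_le_of_plus_eq [CompleteLattice L] {star plus : L → L}
    (h : IsRegularDoubleStoneAlgebra star plus) {p e : L} (hp : IsCompletelyJoinIrreducible p)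
    (hep : e ≤ p) (he : e ≠ ⊥) (hplus : plus e = plus p) : e = p := by
  have hd := h.toIsDoubleStoneAlgebra
  refine h.regular _ _ (le_antisymm ?_ (hd.star_anti hep)) hplus
  -- The Stone identity splits `p` as `(p ⊓ e*) ⊔ (p ⊓ e**)`, and irreducibility makes `p` one of
  -- the two.
  have h₁ := hd.distrib p (star e) (star (star e))
  rw [hd.stone, inf_top_eq, ← sSup_pair] at h₁
  rcases hp.2 _ h₁ with h₂ | h₂
  · have h₃ : e ≤ star e := hep.trans (inf_eq_left.1 h₂.symm)
    exact absurd (le_bot_iff.1 <| (le_inf le_rfl h₃).trans (hd.inf_star e).le) he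
  · have h₃ : p ≤ star (star e) := inf_eq_left.1 h₂.symm
    exact (hd.le_star_star (star e)).trans (hd.star_anti h₃)

/-- An atom that is dense for the dual pseudocomplement is the only element of its component
which lies below a proper element containing the complementary component. -/
theorem eq_of_isAtom [Lattice L] [BoundedOrder L] {star plus : L → L}
    (h : IsRegularDoubleStoneAlgebra star plus) {p e m : L} (hp : IsAtom p) (hplus : plus p = ⊤)
    (hpe : p ≤ e) (he : e ≤ star (star p)) (hem : e ≤ m) (hpm : star p ≤ m) (hm : m ≠ ⊤) :
    e = p := by
  have hd := h.toIsDoubleStoneAlgebra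
  refine h.regular _ _ (le_antisymm (hd.star_anti hpe) ?_) ?_
  · exact (hd.le_star_star (star p)).trans (hd.star_anti he)
  by_contra hne
  have hee : plus (plus e) ≤ e := (hd.plus_spec _ _).2 (by rw [sup_comm, hd.sup_plus])
  -- Otherwise `e⁺⁺` is disjoint from the atom, hence below both `p*` and `p**`; it would vanish and
  -- force `e⁺ = ⊤`.
  have hp_le : p ≤ plus (plus e) := by
    by_contra hnot
    have h₁ : p ⊓ plus (plus e) = ⊥ :=
      (hp.le_iff.1 inf_le_left).resolve_right fun h₂ => hnot (inf_eq_left.1 h₂)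
    have h₂ := hd.eq_bot_of_le_star ((hd.star_spec _ _).2 h₁) (hee.trans he)
    have h₃ := hd.sup_plus (plus e)
    rw [h₂, sup_bot_eq] at h₃
    exact hne (h₃.trans hplus.symm)
  have h₁ : plus e ≤ star p := (hd.star_spec _ _).2 <| le_bot_iff.1 <|
    (inf_le_inf_right _ hp_le).trans (by rw [inf_comm, hd.dual_stone])
  have h₂ : e ⊔ star p = ⊤ :=
    top_le_iff.1 <| (hd.sup_plus e).symm.le.trans (sup_le_sup_left h₁ e)
  exact hm (top_le_iff.1 (h₂.symm.le.trans (sup_le hem hpm)))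

end IsRegularDoubleStoneAlgebra

theorem IsCompletelyJoinIrreducible.of_le_sSup [CompleteLattice L] {j : L} (hj : j ≠ ⊥)
    (h : ∀ S : Set L, j = sSup S → ∃ s ∈ S, j ≤ s) : IsCompletelyJoinIrreducible j := by
  refine ⟨hj, fun S hS => ?_⟩
  obtain ⟨s, hs, hjs⟩ := h S hS
  rwa [le_antisymm hjs (hS ▸ le_sSup hs)]

end Algebra

/-! ### Rough sets, their generators, and cores -/

section Approximations

variable {U : Type u} {R : U → U → Prop}

theorem lower_mono {X Y : Set U} (h : X ⊆ Y) : lower R X ⊆ lower R Y :=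
  fun _ hx => hx.trans h

theorem upper_mono {X Y : Set U} (h : X ⊆ Y) : upper R X ⊆ upper R Y :=
  fun _ ⟨y, hy, hyX⟩ => ⟨y, hy, h hyX⟩

theorem mem_upper_singleton {x y : U} : y ∈ upper R {x} ↔ R y x :=
  ⟨fun ⟨_, hz, hzx⟩ => hzx ▸ hz, fun h => ⟨x, h, rfl⟩⟩

variable (R) in
/-- The element of the Dedekind–MacNeille completion given by the rough set of `X`. -/
def roughCut (X : Set U) : DMRS R :=
  DedekindCut.principal ⟨(lower R X, upper R X), X, rfl⟩

theorem roughCut_le_roughCut {X Y : Set U} :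
    roughCut R X ≤ roughCut R Y ↔ lower R X ⊆ lower R Y ∧ upper R X ⊆ upper R Y :=
  DedekindCut.principal_le_principal

theorem roughCut_mono {X Y : Set U} (h : X ⊆ Y) : roughCut R X ≤ roughCut R Y :=
  roughCut_le_roughCut.2 ⟨lower_mono h, upper_mono h⟩

theorem le_of_forall_roughCut_le {e f : DMRS R}
    (h : ∀ X, roughCut R X ≤ e → roughCut R X ≤ f) : e ≤ f := by
  rw [← Concept.extent_subset_extent_iff]
  rintro ⟨_, X, rfl⟩ hX
  exact DedekindCut.principal_le_iff.1 (h X (DedekindCut.principal_le_iff.2 hX))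

theorem le_of_forall_le_roughCut {e f : DMRS R}
    (h : ∀ X, f ≤ roughCut R X → e ≤ roughCut R X) : e ≤ f := by
  rw [← Concept.intent_subset_intent_iff]
  rintro ⟨_, X, rfl⟩ hX
  exact DedekindCut.le_principal_iff.1 (h X (DedekindCut.le_principal_iff.2 hX))

/-- Every rough set is generated by those of singletons and neighbourhoods. -/
theorem roughCut_le_iff {X : Set U} {f : DMRS R} :
    roughCut R X ≤ f ↔ (∀ x ∈ X, roughCut R {x} ≤ f) ∧
      ∀ x, neighbourhood R x ⊆ X → roughCut R (neighbourhood R x) ≤ f := by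
  refine ⟨fun h => ⟨fun x hx => (roughCut_mono (Set.singleton_subset_iff.2 hx)).trans h,
    fun x hx => (roughCut_mono hx).trans h⟩, fun ⟨h₁, h₂⟩ => ?_⟩
  refine le_of_forall_le_roughCut fun Y hY => roughCut_le_roughCut.2 ⟨fun x hx => ?_, ?_⟩
  · exact (roughCut_le_roughCut.1 ((h₂ x hx).trans hY)).1 (Set.Subset.refl _)
  · rintro y ⟨x, hyx, hx⟩
    exact (roughCut_le_roughCut.1 ((h₁ x hx).trans hY)).2 (mem_upper_singleton.2 hyx)

theorem le_of_forall_generator_le {e f : DMRS R}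
    (h₁ : ∀ x, roughCut R {x} ≤ e → roughCut R {x} ≤ f)
    (h₂ : ∀ x, roughCut R (neighbourhood R x) ≤ e → roughCut R (neighbourhood R x) ≤ f) :
    e ≤ f :=
  le_of_forall_roughCut_le fun _ hX =>
    have hX' := roughCut_le_iff.1 hX
    roughCut_le_iff.2 ⟨fun x hx => h₁ x (hX'.1 x hx), fun x hx => h₂ x (hX'.2 x hx)⟩

theorem IsCompletelyJoinIrreducible.exists_generator {p : DMRS R}
    (hp : IsCompletelyJoinIrreducible p) :
    (∃ x, p = roughCut R {x}) ∨ ∃ x, p = roughCut R (neighbourhood R x) := by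
  have h : p ∈ {q : DMRS R | ((∃ x, q = roughCut R {x}) ∨
      ∃ x, q = roughCut R (neighbourhood R x)) ∧ q ≤ p} := by
    refine hp.2 _ (le_antisymm (le_of_forall_generator_le ?_ ?_) (sSup_le fun q hq => hq.2))
    · exact fun x hx => le_sSup ⟨Or.inl ⟨x, rfl⟩, hx⟩
    · exact fun x hx => le_sSup ⟨Or.inr ⟨x, rfl⟩, hx⟩
  exact h.1

theorem roughCut_univ : roughCut R Set.univ = ⊤ :=
  top_le_iff.1 <| le_of_forall_roughCut_le fun X _ => roughCut_mono (Set.subset_univ X)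

theorem mem_of_mem_lower (hR : ∀ x, R x x) {X : Set U} {x : U} (h : x ∈ lower R X) : x ∈ X :=
  h (hR x)

theorem roughCut_ne_bot (hR : ∀ x, R x x) {X : Set U} (hX : X.Nonempty) :
    roughCut R X ≠ ⊥ := by
  obtain ⟨x, hx⟩ := hX
  intro h
  obtain ⟨_, _, hy⟩ :=
    (roughCut_le_roughCut.1 (h.le.trans (bot_le : ⊥ ≤ roughCut R ∅))).2 ⟨x, hR x, hx⟩
  exact hy

theorem roughCut_compl_singleton_ne_top (hR : ∀ x, R x x) (c : U) : roughCut R {c}ᶜ ≠ ⊤ := by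
  intro h
  have h₁ := (roughCut_le_roughCut.1 ((roughCut_univ (R := R)).trans h.symm).le).1
  exact mem_of_mem_lower hR (h₁ (Set.subset_univ (neighbourhood R c))) rfl

/-- Co-singletons serve as test elements for properness: a set omitting `c` lies inside `{c}ᶜ`. -/
theorem exists_le_roughCut_compl_singleton {f : DMRS R} (hf : f ≠ ⊤) :
    ∃ c, f ≤ roughCut R {c}ᶜ := by
  by_contra! h
  refine hf (top_le_iff.1 (le_of_forall_le_roughCut fun X hX => ?_))
  suffices X = Set.univ by rw [this, roughCut_univ]
  refine Set.eq_univ_of_forall fun c => by_contra fun hc => h c (hX.trans (roughCut_mono ?_))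
  exact Set.subset_compl_singleton_iff.2 hc

theorem roughCut_singleton_le_compl_of_ne {x c : U} (h : x ≠ c) :
    roughCut R {x} ≤ roughCut R {c}ᶜ :=
  roughCut_mono (Set.singleton_subset_iff.2 h)

theorem lower_singleton_eq_empty (hR : ∀ x, R x x) {x : U} (hx : ¬ neighbourhood R x ⊆ {x}) :
    lower R {x} = ∅ := by
  refine Set.eq_empty_of_forall_notMem fun w hw => hx ?_
  have hwx : w = x := mem_of_mem_lower (X := {x}) hR hw
  exact hwx ▸ hw

/-- Even `c = x` is allowed: the lower part of `{x}` is empty, and each point related to `x` is also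
related to some other point (itself, or for `x` a second neighbour). -/
theorem roughCut_singleton_le_compl (hR : ∀ x, R x x) {x : U}
    (hx : ¬ neighbourhood R x ⊆ {x}) (c : U) : roughCut R {x} ≤ roughCut R {c}ᶜ := by
  by_cases hxc : x = c
  · subst hxc
    refine roughCut_le_roughCut.2 ⟨by simp [lower_singleton_eq_empty hR hx], fun u hu => ?_⟩
    have hux : R u x := mem_upper_singleton.1 hu
    by_cases h : u = x
    · subst h
      obtain ⟨y, hy, hyx⟩ := Set.not_subset.1 hx
      exact ⟨y, hy, hyx⟩
    · exact ⟨u, hR u, h⟩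
  · exact roughCut_singleton_le_compl_of_ne hxc

theorem not_roughCut_neighbourhood_le_singleton (hR : ∀ x, R x x) {x : U}
    (hx : ¬ neighbourhood R x ⊆ {x}) (w : U) :
    ¬ roughCut R (neighbourhood R w) ≤ roughCut R {x} := by
  intro h
  have h₁ : w ∈ lower R {x} := (roughCut_le_roughCut.1 h).1 (Set.Subset.refl _)
  rw [lower_singleton_eq_empty hR hx] at h₁
  exact h₁

theorem plus_roughCut_singleton (hR : ∀ x, R x x) {star plus : DMRS R → DMRS R}
    (h : IsDoubleStoneAlgebra star plus) {x : U} (hx : ¬ neighbourhood R x ⊆ {x}) :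
    plus (roughCut R {x}) = ⊤ := by
  by_contra hne
  obtain ⟨c, hc⟩ := exists_le_roughCut_compl_singleton hne
  refine roughCut_compl_singleton_ne_top hR c (top_le_iff.1 ?_)
  rw [← h.sup_plus (roughCut R {x})]
  exact sup_le (roughCut_singleton_le_compl hR hx c) hc

theorem exists_roughCut_singleton_le (hR : ∀ x, R x x) {x : U}
    (hx : ¬ neighbourhood R x ⊆ {x}) {q : DMRS R} (hq : q ≠ ⊥) (hqx : q ≤ roughCut R {x}) :
    ∃ y, ¬ neighbourhood R y ⊆ {y} ∧ roughCut R {y} ≤ q := by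
  by_contra! h
  refine hq (le_bot_iff.1 (le_of_forall_generator_le (fun y hy => ?_) fun y hy => ?_))
  · by_cases hyn : neighbourhood R y ⊆ {y}
    · exact absurd ((roughCut_mono hyn).trans (hy.trans hqx))
        (not_roughCut_neighbourhood_le_singleton hR hx y)
    · exact absurd hy (h y hyn)
  · exact absurd (hy.trans hqx) (not_roughCut_neighbourhood_le_singleton hR hx y)

/-- In a spatial regular double Stone algebra, every singleton rough set without lower part
contains an atom of the same form. -/
theorem exists_isAtom_roughCut_singleton_le (hR : ∀ x, R x x) {star plus : DMRS R → DMRS R}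
    (h : IsRegularDoubleStoneAlgebra star plus) (hs : IsSpatial (DMRS R)) {x : U}
    (hx : ¬ neighbourhood R x ⊆ {x}) :
    ∃ z, ¬ neighbourhood R z ⊆ {z} ∧ IsAtom (roughCut R {z}) ∧
      roughCut R {z} ≤ roughCut R {x} := by
  have hd := h.toIsDoubleStoneAlgebra
  obtain ⟨p, hp, hpx⟩ : ∃ p, IsCompletelyJoinIrreducible p ∧ p ≤ roughCut R {x} := by
    by_contra! hne
    refine roughCut_ne_bot hR (Set.singleton_nonempty x) (le_bot_iff.1 ?_)
    rw [hs (roughCut R {x})]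
    exact sSup_le fun q hq => absurd hq.2 (hne q hq.1)
  have hgen : ∃ z, ¬ neighbourhood R z ⊆ {z} ∧ p = roughCut R {z} := by
    rcases hp.exists_generator with ⟨z, hz⟩ | ⟨z, rfl⟩
    · refine ⟨z, fun hzn => ?_, hz⟩
      exact not_roughCut_neighbourhood_le_singleton hR hx z
        ((roughCut_mono hzn).trans (hz ▸ hpx))
    · exact absurd hpx (not_roughCut_neighbourhood_le_singleton hR hx z)
  obtain ⟨z, hz, rfl⟩ := hgen
  refine ⟨z, hz, ⟨hp.1, fun q hq => by_contra fun hq0 => ?_⟩, hpx⟩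
  obtain ⟨y, hy, hyq⟩ := exists_roughCut_singleton_le hR hz hq0 hq.le
  have := h.eq_of_le_of_plus_eq hp (hyq.trans hq.le)
    (roughCut_ne_bot hR (Set.singleton_nonempty y))
    ((plus_roughCut_singleton hR hd hy).trans (plus_roughCut_singleton hR hd hz).symm)
  exact (this ▸ hyq).not_gt hq

theorem star_roughCut_singleton_le_compl (hR : ∀ x, R x x) {star plus : DMRS R → DMRS R}
    (h : IsDoubleStoneAlgebra star plus) (z : U) (hz : ¬ neighbourhood R z ⊆ {z}) :
    star (roughCut R {z}) ≤ roughCut R {z}ᶜ := by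
  refine le_of_forall_generator_le (fun y _ => ?_) fun y hy => roughCut_mono ?_
  · by_cases hyz : y = z
    · exact hyz ▸ roughCut_singleton_le_compl hR hz z
    · exact roughCut_singleton_le_compl_of_ne hyz
  · refine Set.subset_compl_singleton_iff.2 fun hzy => ?_
    have h₁ := (roughCut_mono (Set.singleton_subset_iff.2 hzy)).trans hy
    exact roughCut_ne_bot hR (Set.singleton_nonempty z)
      (h.eq_bot_of_le_star h₁ (h.le_star_star _))

/-- An atom `roughCut R {z}` has a core: a point related to `z` whose neighbourhood consists only of
points generating the same atom. -/
theorem exists_core_of_isAtom (hR : ∀ x, R x x) {star plus : DMRS R → DMRS R}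
    (h : IsRegularDoubleStoneAlgebra star plus) {z : U} (hz : ¬ neighbourhood R z ⊆ {z})
    (ha : IsAtom (roughCut R {z})) :
    ∃ w, R w z ∧ ∀ y, R w y → roughCut R {y} = roughCut R {z} := by
  have hd := h.toIsDoubleStoneAlgebra
  have hm := roughCut_compl_singleton_ne_top hR z
  have hstar := star_roughCut_singleton_le_compl hR hd z hz
  have hnot : ¬ star (star (roughCut R {z})) ≤ roughCut R {z}ᶜ := fun hle =>
    hm (top_le_iff.1 ((hd.stone _).symm.le.trans (sup_le hstar hle)))
  have hsing : ∀ y, roughCut R {y} ≤ roughCut R {z}ᶜ := fun y => by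
    by_cases hyz : y = z
    · exact hyz ▸ roughCut_singleton_le_compl hR hz z
    · exact roughCut_singleton_le_compl_of_ne hyz
  -- Singletons all lie below `{z}ᶜ`, so the generator separating `{z}**` from it is a
  -- neighbourhood.
  obtain ⟨w, hw, hwz⟩ : ∃ w, roughCut R (neighbourhood R w) ≤ star (star (roughCut R {z})) ∧
      ¬ roughCut R (neighbourhood R w) ≤ roughCut R {z}ᶜ := by
    by_contra! hc
    exact hnot (le_of_forall_generator_le (fun y _ => hsing y) hc)
  refine ⟨w, by_contra fun hwR => hwz (roughCut_mono (Set.subset_compl_singleton_iff.2 hwR)),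
    fun y hy => ?_⟩
  have hy' := (roughCut_mono (R := R) (Set.singleton_subset_iff.2 hy)).trans hw
  refine h.eq_of_isAtom ha (plus_roughCut_singleton hR hd hz) ?_ hy' (hsing y) hstar hm
  by_contra hle
  have h₁ : roughCut R {z} ⊓ roughCut R {y} = ⊥ :=
    (ha.le_iff.1 inf_le_left).resolve_right fun h₂ => hle (inf_eq_left.1 h₂)
  exact roughCut_ne_bot hR (Set.singleton_nonempty y)
    (hd.eq_bot_of_le_star ((hd.star_spec _ _).2 h₁) hy')

theorem exists_core (hR : ∀ x, R x x) {star plus : DMRS R → DMRS R}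
    (h : IsRegularDoubleStoneAlgebra star plus) (hs : IsSpatial (DMRS R)) (x : U) :
    ∃ w, R w x ∧ ∀ y, R w y → upper R {y} = upper R {x} := by
  by_cases hx : neighbourhood R x ⊆ {x}
  · exact ⟨x, hR x, fun y hy => by rw [hx hy]⟩
  obtain ⟨z, hz, ha, hzx⟩ := exists_isAtom_roughCut_singleton_le hR h hs hx
  obtain ⟨w, hwz, hw⟩ := exists_core_of_isAtom hR h hz ha
  have hw' : ∀ y, R w y → upper R {y} = upper R {z} := fun y hy =>
    Set.Subset.antisymm (roughCut_le_roughCut.1 (hw y hy).le).2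
      (roughCut_le_roughCut.1 (hw y hy).ge).2
  have hwx : R w x := mem_upper_singleton.1
    ((roughCut_le_roughCut.1 hzx).2 (mem_upper_singleton.2 hwz))
  exact ⟨w, hwx, fun y hy => (hw' y hy).trans (hw' x hwx).symm⟩

/-- A reflexive relation is a clinker equivalence iff every point has a core. -/
theorem isClinkerEquivalence_iff (hR : ∀ x, R x x) :
    IsClinkerEquivalence R ↔
      ∀ x, ∃ w, R w x ∧ ∀ y, R w y → upper R {y} = upper R {x} := by
  constructor
  · intro h x
    by_contra! hc
    -- Without a core for `x`, every point of `upper R {x}` lies in a different member, so this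
    -- member could be dropped.
    refine h.irredundant.2 (upper R {x}) ⟨x, rfl⟩
      ⟨fun X hX => h.irredundant.1.1 X hX.1, Set.eq_univ_of_forall fun w => ?_⟩
    by_cases hwx : R w x
    · obtain ⟨y, hy, hne⟩ := hc w hwx
      exact ⟨upper R {y}, ⟨⟨y, rfl⟩, hne⟩, mem_upper_singleton.2 hy⟩
    · refine ⟨upper R {w}, ⟨⟨w, rfl⟩, fun heq => hwx ?_⟩, mem_upper_singleton.2 (hR w)⟩
      exact mem_upper_singleton.1 (heq.subset (mem_upper_singleton.2 (hR w)))
  · refine fun h => ⟨hR, ⟨?_, ?_⟩, ?_⟩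
    · rintro _ ⟨x, rfl⟩
      exact ⟨x, mem_upper_singleton.2 (hR x)⟩
    · exact Set.eq_univ_of_forall fun x => ⟨_, ⟨x, rfl⟩, mem_upper_singleton.2 (hR x)⟩
    · rintro _ ⟨x, rfl⟩ hcov
      obtain ⟨w, -, hw⟩ := h x
      obtain ⟨_, ⟨⟨y, rfl⟩, hne⟩, hwy⟩ := hcov.2.symm.subset (Set.mem_univ w)
      exact hne (hw y (mem_upper_singleton.1 hwy))

end Approximations

/-! ### The lattice of nested pairs -/

section Representation

variable {C : Type u}

/-- The complete lattice of pairs of nested sets which agree on `K`. -/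
def nestedPairs (K : Set C) : CompleteSublattice (Set C × Set C) :=
  CompleteSublattice.mk' {p | p.1 ⊆ p.2 ∧ p.2 ∩ K ⊆ p.1}
    (fun s hs => by
      refine ⟨?_, ?_⟩
      · rw [Prod.fst_sSup, Prod.snd_sSup]
        rintro c ⟨_, ⟨p, hp, rfl⟩, hc⟩
        exact ⟨_, ⟨p, hp, rfl⟩, (hs hp).1 hc⟩
      · rw [Prod.fst_sSup, Prod.snd_sSup]
        rintro c ⟨⟨_, ⟨p, hp, rfl⟩, hc⟩, hcK⟩
        exact ⟨_, ⟨p, hp, rfl⟩, (hs hp).2 ⟨hc, hcK⟩⟩)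
    (fun s hs => by
      refine ⟨?_, ?_⟩
      · rw [Prod.fst_sInf, Prod.snd_sInf]
        rintro c hc _ ⟨p, hp, rfl⟩
        exact (hs hp).1 (hc _ ⟨p, hp, rfl⟩)
      · rw [Prod.fst_sInf, Prod.snd_sInf]
        rintro c ⟨hc, hcK⟩ _ ⟨p, hp, rfl⟩
        exact (hs hp).2 ⟨hc _ ⟨p, hp, rfl⟩, hcK⟩)

variable {L : Type u} [CompleteLattice L] {K : Set C}

/-- Joins and meets are those of a product of power sets, which is completely distributive. -/
theorem isCompletelyDistributive_of_orderIso (e : L ≃o nestedPairs K) :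
    IsCompletelyDistributive L := by
  intro I J a
  apply e.injective
  apply Subtype.ext
  simp only [map_iInf, map_iSup, CompleteSublattice.coe_iInf, CompleteSublattice.coe_iSup]
  exact iInf_iSup_eq

/-- The pairs `({c}, {c})`, and `(∅, {c})` for `c ∉ K`, are irreducible because joins are unions;
they generate everything. -/
theorem isSpatial_of_orderIso (e : L ≃o nestedPairs K) : IsSpatial L := by
  have hmono : ∀ {a b : L}, a ≤ b ↔ (e a).1.1 ⊆ (e b).1.1 ∧ (e a).1.2 ⊆ (e b).1.2 :=
    fun {a b} => (e.le_iff_le (x := a) (y := b)).symm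
  have hsup : ∀ S : Set L, (e (sSup S)).1 = ⨆ s ∈ S, (e s).1 := fun S => by
    rw [map_sSup, CompleteSublattice.coe_sSup', iSup_image]
  have hbot : (e ⊥).1 = ⊥ := by rw [map_bot]; rfl
  have hfst : ∀ S : Set L, (e (sSup S)).1.1 = ⋃ s ∈ S, (e s).1.1 := fun S => by
    simp only [hsup, Prod.fst_iSup, Set.iSup_eq_iUnion]
  have hsnd : ∀ S : Set L, (e (sSup S)).1.2 = ⋃ s ∈ S, (e s).1.2 := fun S => by
    simp only [hsup, Prod.snd_iSup, Set.iSup_eq_iUnion]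
  have hK : ∀ c ∉ K, ((∅, {c}) : Set C × Set C) ∈ nestedPairs K := fun c hc =>
    ⟨Set.empty_subset _, by rintro _ ⟨rfl, h⟩; exact absurd h hc⟩
  have hC : ∀ c, (({c}, {c}) : Set C × Set C) ∈ nestedPairs K := fun c =>
    ⟨Set.Subset.refl _, Set.inter_subset_left⟩
  have hirrK : ∀ c (hc : c ∉ K), IsCompletelyJoinIrreducible (e.symm ⟨_, hK c hc⟩) := by
    refine fun c hc => .of_le_sSup (fun h => ?_) fun S hS => ?_
    · rw [← h, e.apply_symm_apply] at hbot
      exact (congrArg Prod.snd hbot).subset rfl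
    · have h := hsnd S
      rw [← hS, e.apply_symm_apply] at h
      obtain ⟨s, hs, hcs⟩ := Set.mem_iUnion₂.1 (h.subset rfl)
      refine ⟨s, hs, hmono.2 ?_⟩
      rw [e.apply_symm_apply]
      exact ⟨Set.empty_subset _, Set.singleton_subset_iff.2 hcs⟩
  have hirrC : ∀ c, IsCompletelyJoinIrreducible (e.symm ⟨_, hC c⟩) := by
    refine fun c => .of_le_sSup (fun h => ?_) fun S hS => ?_
    · rw [← h, e.apply_symm_apply] at hbot
      exact (congrArg Prod.snd hbot).subset rfl
    · have h := hfst S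
      rw [← hS, e.apply_symm_apply] at h
      obtain ⟨s, hs, hcs⟩ := Set.mem_iUnion₂.1 (h.subset rfl)
      refine ⟨s, hs, hmono.2 ?_⟩
      rw [e.apply_symm_apply]
      exact ⟨Set.singleton_subset_iff.2 hcs, Set.singleton_subset_iff.2 ((e s).2.1 hcs)⟩
  intro a
  have hfull : ∀ c ∈ (e a).1.1, e.symm ⟨_, hC c⟩ ≤ a := fun c hc => by
    rw [hmono, e.apply_symm_apply]
    exact ⟨Set.singleton_subset_iff.2 hc, Set.singleton_subset_iff.2 ((e a).2.1 hc)⟩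
  refine le_antisymm (hmono.2 ⟨fun c hc => ?_, fun c hc => ?_⟩) (sSup_le fun j hj => hj.2)
  · rw [hfst]
    refine Set.mem_iUnion₂.2 ⟨_, ⟨hirrC c, hfull c hc⟩, ?_⟩
    rw [e.apply_symm_apply]
    rfl
  · rw [hsnd]
    by_cases hcK : c ∈ K
    · refine Set.mem_iUnion₂.2 ⟨_, ⟨hirrC c, hfull c ((e a).2.2 ⟨hc, hcK⟩)⟩, ?_⟩
      rw [e.apply_symm_apply]
      rfl
    · refine Set.mem_iUnion₂.2 ⟨_, ⟨hirrK c hcK, hmono.2 ?_⟩, ?_⟩ <;> rw [e.apply_symm_apply]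
      · exact ⟨Set.empty_subset _, Set.singleton_subset_iff.2 hc⟩
      · rfl

/-- For a pair `(A, B)` take `star = (Bᶜ, Bᶜ)` and `plus = (Aᶜ, Aᶜ)`. Diagonal pairs are
complemented, giving the Stone identities; the two operations recover `B` and `A`, giving
regularity. -/
theorem formsRegularDoubleStoneAlgebra_of_orderIso (e : L ≃o nestedPairs K) :
    FormsRegularDoubleStoneAlgebra L := by
  have hmono : ∀ {a b : L}, a ≤ b ↔ (e a).1.1 ⊆ (e b).1.1 ∧ (e a).1.2 ⊆ (e b).1.2 :=
    fun {a b} => (e.le_iff_le (x := a) (y := b)).symm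
  have hinj : ∀ {a b : L}, (e a).1.1 = (e b).1.1 → (e a).1.2 = (e b).1.2 → a = b :=
    fun h₁ h₂ => e.injective (Subtype.ext (Prod.ext h₁ h₂))
  have hsup : ∀ a b : L, (e (a ⊔ b)).1 = (e a).1 ⊔ (e b).1 := fun a b => by
    rw [map_sup]; rfl
  have hinf : ∀ a b : L, (e (a ⊓ b)).1 = (e a).1 ⊓ (e b).1 := fun a b => by
    rw [map_inf]; rfl
  have hbot : (e ⊥).1 = (∅, ∅) := by rw [map_bot]; rfl
  have htop : (e ⊤).1 = (Set.univ, Set.univ) := by rw [map_top]; rfl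
  have hdiag : ∀ A : Set C, ((A, A) : Set C × Set C) ∈ nestedPairs K := fun A =>
    ⟨Set.Subset.refl _, Set.inter_subset_left⟩
  have hdisj : ∀ x z : L, x ⊓ z = ⊥ ↔ (e x).1.2 ∩ (e z).1.2 = ∅ := fun x z => by
    refine ⟨fun h => ?_, fun h => ?_⟩
    · have := congrArg Prod.snd (hinf x z)
      rw [h, hbot] at this
      exact this.symm
    · refine le_bot_iff.1 (hmono.2 ?_)
      rw [hinf]
      refine ⟨fun c hc => ?_, fun c hc => ?_⟩
      · exact (h.subset ⟨(e x).2.1 hc.1, (e z).2.1 hc.2⟩).elim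
      · exact (h.subset hc).elim
  have hcodisj : ∀ x z : L, x ⊔ z = ⊤ ↔ (e x).1.1 ∪ (e z).1.1 = Set.univ := fun x z => by
    refine ⟨fun h => ?_, fun h => ?_⟩
    · have := congrArg Prod.fst (hsup x z)
      rw [h, htop] at this
      exact this.symm
    · refine top_le_iff.1 (hmono.2 ?_)
      rw [hsup]
      refine ⟨fun c _ => h.symm.subset (Set.mem_univ c), fun c _ => ?_⟩
      exact (h.symm.subset (Set.mem_univ c)).imp (fun hc => (e x).2.1 hc) fun hc => (e z).2.1 hc
  let star : L → L := fun x => e.symm ⟨((e x).1.2ᶜ, (e x).1.2ᶜ), hdiag _⟩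
  let plus : L → L := fun x => e.symm ⟨((e x).1.1ᶜ, (e x).1.1ᶜ), hdiag _⟩
  have hstar : ∀ x, (e (star x)).1 = ((e x).1.2ᶜ, (e x).1.2ᶜ) := fun x => by simp [star]
  have hplus : ∀ x, (e (plus x)).1 = ((e x).1.1ᶜ, (e x).1.1ᶜ) := fun x => by simp [plus]
  refine ⟨star, plus, ⟨fun x y z => ?_, fun x z => ?_, fun x z => ?_, fun x => ?_, fun x => ?_⟩,
    fun x y h₁ h₂ => ?_⟩
  · apply e.injective
    apply Subtype.ext
    simp only [hinf, hsup, inf_sup_left]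
  · rw [hdisj, hmono, hstar, ← Set.disjoint_iff_inter_eq_empty, disjoint_comm]
    simp only [Set.subset_compl_iff_disjoint_right]
    exact ⟨And.right, fun h => ⟨h.mono_left (e z).2.1, h⟩⟩
  · rw [hcodisj, hmono, hplus]
    simp only [Set.compl_subset_iff_union]
    refine ⟨And.left, fun h => ⟨h, ?_⟩⟩
    exact Set.eq_univ_of_univ_subset (h ▸ Set.union_subset_union_right _ (e z).2.1)
  · rw [hcodisj, hstar (star x), hstar x]
    simp
  · rw [hdisj, hplus (plus x), hplus x]
    simp
  · refine hinj ?_ ?_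
    · have := congrArg (fun a => (e a).1.1) h₂
      simpa [hplus] using this
    · have := congrArg (fun a => (e a).1.1) h₁
      simpa [hstar] using this

end Representation

/-! ### Clinker equivalences yield nested pairs -/

section Clinker

variable {U C : Type u} {R : U → U → Prop} {q : U → C} {k : C → U}

theorem mem_lower_core (hk : ∀ c y, R (k c) y ↔ q y = c) {X : Set U} {c : C} :
    k c ∈ lower R X ↔ ∀ y, q y = c → y ∈ X :=
  forall_congr' fun y => imp_congr_left (hk c y)

theorem mem_upper_core (hk : ∀ c y, R (k c) y ↔ q y = c) {X : Set U} {c : C} :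
    k c ∈ upper R X ↔ ∃ y, q y = c ∧ y ∈ X :=
  exists_congr fun y => and_congr_left' (hk c y)

/-- If `R` depends on its second argument only through `q` and `k` selects cores of the fibres
of `q`, then the rough sets form the lattice of nested pairs agreeing on one-element fibres. -/
theorem nonempty_orderIso_nestedPairs (hR : ∀ x, R x x)
    (hq : ∀ w x y, q x = q y → R w x → R w y) (hk : ∀ c y, R (k c) y ↔ q y = c) :
    Nonempty (DMRS R ≃o nestedPairs {c | ∀ y, q y = c → y = k c}) := by
  have hqk : ∀ c, q (k c) = c := fun c => (hk c _).1 (hR _)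
  let f : RS R ↪o nestedPairs {c | ∀ y, q y = c → y = k c} :=
    OrderEmbedding.ofMapLEIff
      (fun p => ⟨({c | k c ∈ p.1.1}, {c | k c ∈ p.1.2}), by
        obtain ⟨_, X, rfl⟩ := p
        refine ⟨fun c hc => (mem_upper_core hk).2 ?_, ?_⟩
        · exact ⟨k c, hqk c, (mem_lower_core hk).1 hc _ (hqk c)⟩
        · rintro c ⟨hc, hcK⟩
          obtain ⟨y, hy, hyX⟩ := (mem_upper_core hk).1 hc
          exact (mem_lower_core hk).2 fun z hz => by rwa [hcK z hz, ← hcK y hy]⟩) <| by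
      rintro ⟨_, X, rfl⟩ ⟨_, Y, rfl⟩
      refine ⟨fun h => ⟨fun w hw y hy => ?_, ?_⟩, fun h => ⟨fun c hc => h.1 hc, fun c hc => h.2 hc⟩⟩
      -- `R(w)` contains the whole fibre of `y`, so inclusion at `w` can be tested at the core of
      -- that fibre.
      · have h₁ : k (q y) ∈ lower R X :=
          (mem_lower_core hk).2 fun z hz => hw (hq w y z hz.symm hy)
        have h₂ : k (q y) ∈ lower R Y := h.1 h₁
        exact (mem_lower_core hk).1 h₂ y rfl
      · rintro w ⟨y, hy, hyX⟩
        have h₁ : k (q y) ∈ upper R X := (mem_upper_core hk).2 ⟨y, rfl, hyX⟩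
        have h₂ : k (q y) ∈ upper R Y := h.2 h₁
        obtain ⟨z, hz, hzY⟩ := (mem_upper_core hk).1 h₂
        exact ⟨z, hq w y z hz.symm hy, hzY⟩
  have hf : Function.Surjective f := by
    rintro ⟨⟨A, B⟩, hAB, hBA⟩
    -- Whole fibres over `A`, one point of each fibre over `B \ A`; such fibres have a second point,
    -- so their cores stay out of the lower approximation.
    let X : Set U := {x | q x ∈ A ∨ q x ∈ B ∧ x = k (q x)}
    refine ⟨⟨_, X, rfl⟩, Subtype.ext (Prod.ext (Set.ext fun c => ?_) (Set.ext fun c => ?_))⟩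
    · refine (mem_lower_core hk).trans ⟨fun h => by_contra fun hc => hc ?_, ?_⟩
      · have h₁ : ∀ y, q y = c → c ∈ B ∧ y = k c := by
          rintro y rfl
          exact (h y rfl).resolve_left hc
        exact hBA ⟨(h₁ _ (hqk c)).1, fun y hy => (h₁ y hy).2⟩
      · rintro hc y rfl
        exact Or.inl hc
    · refine (mem_upper_core hk).trans ⟨?_, fun hc => ⟨k c, hqk c, Or.inr ?_⟩⟩
      · rintro ⟨y, rfl, hy | hy⟩
        exacts [hAB hy, hy.1]
      · rw [hqk]
        exact ⟨hc, rfl⟩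
  -- The embedding of the completion induced by `f` is onto because principal cuts already reach
  -- every pair.
  refine ⟨RelIso.ofSurjective (DedekindCut.factorEmbedding f) fun m => ?_⟩
  obtain ⟨p, rfl⟩ := hf m
  exact ⟨DedekindCut.principal p, DedekindCut.factorEmbedding_principal f p⟩

theorem IsClinkerEquivalence.exists_orderIso (h : IsClinkerEquivalence R) :
    ∃ (C : Type u) (K : Set C), Nonempty (DMRS R ≃o nestedPairs K) := by
  have hcore := (isClinkerEquivalence_iff h.refl).1 h
  let q : U → Quotient (Setoid.ker fun x => upper R {x}) := Quotient.mk _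
  have hqeq : ∀ {x y}, q x = q y ↔ upper R {x} = upper R {y} := Quotient.eq
  have hq : ∀ w x y, q x = q y → R w x → R w y := fun w x y hxy hw =>
    mem_upper_singleton.1 ((hqeq.1 hxy).subset (mem_upper_singleton.2 hw))
  have hex : ∀ c, ∃ w, ∀ y, R w y ↔ q y = c := fun c => by
    obtain ⟨x, rfl⟩ := Quotient.exists_rep c
    obtain ⟨w, hwx, hw⟩ := hcore x
    exact ⟨w, fun y => ⟨fun hy => hqeq.2 (hw y hy), fun hy => hq w x y hy.symm hwx⟩⟩
  choose k hk using hex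
  exact ⟨_, _, nonempty_orderIso_nestedPairs h.refl hq hk⟩

end Clinker

end RoughSet

theorem mainTheorem2 {U : Type u} (R : U → U → Prop) (hR : ∀ x, R x x) :
    (RoughSet.FormsRegularDoubleStoneAlgebra (RoughSet.DMRS R) ∧
      RoughSet.IsCompletelyDistributive (RoughSet.DMRS R) ∧
      RoughSet.IsSpatial (RoughSet.DMRS R)) ↔
    RoughSet.IsClinkerEquivalence R := by
  constructor
  · rintro ⟨⟨star, plus, h⟩, -, hs⟩
    exact (RoughSet.isClinkerEquivalence_iff hR).2 (RoughSet.exists_core hR h hs)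
  · intro h
    obtain ⟨C, K, ⟨e⟩⟩ := h.exists_orderIso
    exact ⟨RoughSet.formsRegularDoubleStoneAlgebra_of_orderIso e,
      RoughSet.isCompletelyDistributive_of_orderIso e, RoughSet.isSpatial_of_orderIso e⟩
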